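/- Let $\mathcal H$ be a real Hilbert space with identity $\mathrm{Id}$, let $x_0\in\mathcal H$, and let $J$ and $K$ be at most countable sets with $J\cap K=\varnothing$ and $J\cup K\neq\varnothing$. For every $j\in J$, let $C_j$ be a closed convex subset of $\mathcal H$ and, for every $k\in K$, let $p_k\in\mathcal H$ and let $F_k\colon\mathcal H\to\mathcal H$ be firmly nonexpansive, i.e., $$\|F_kx-F_ky\|^2+\|(\mathrm{Id}-F_k)x-(\mathrm{Id}-F_k)y\|^2\leq\|x-y\|^2\quad\text{for all }x,y\in\mathcal H.$$ Suppose that there exists $\overline x\in\bigcap_{j\in J}C_j$ such that $F_k\overline x=p_k$ for every $k\in K$. Consider the problem $$\text{minimize}\ \|x-x_0\|\quad\text{subject to}\quad x\in\bigcap_{j\in J}C_j\ \text{ and }\ (\forall k\in K)\ F_kx=p_k.\tag{P}$$ Let $\mathfrak T$ be the class of firmly quasinonexpansive operators, i.e., of those $T\colon\mathcal H\to\mathcal H$ such that $\langle y-Tx,\,x-Tx\rangle\leq 0$ for every $x\in\mathcal H$ and every $y\in\mathrm{Fix}\,T=\{y\in\mathcal H : Ty=y\}$. For $s,t\in\mathcal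 H$ such that $$D(x_0,s,t)=\{x\in\mathcal H : \langle x-s,\,x_0-s\rangle\leq 0\ \text{and}\ \langle x-t,\,s-t\rangle\leq 0\}\neq\varnothing,$$ set $\chi=\langle x_0-s,\,s-t\rangle$, $\mu=\|x_0-s\|^2$, $\nu=\|s-t\|^2$, $\rho=\mu\nu-\chi^2$, and $$Q(x_0,s,t)=\begin{cases}t,&\text{if }\rho=0\text{ and }\chi\geq 0;\\ x_0+\big(1+\frac{\chi}{\nu}\big)(t-s),&\text{if }\rho>0\text{ and }\chi\nu\geq\rho;\\ s+\frac{\nu}{\rho}\big(\chi(x_0-s)+\mu(t-s)\big),&\text{if }\rho>0\text{ and }\chi\nu<\rho,\end{cases}$$ which covers all cases with $D(x_0,s,t)\neq\varnothing$. Fix $\varepsilon\in\left]0,1\right[$ and, starting at $x_0$, let $(x_n)_{n\in\mathbb N}$ be generated as follows. For $n=0,1,\ldots$: * take a nonempty finite set $I_n\subset J\cup K$; * for every $i\in I_n\cap J$, take $T_{i,n}\in\mathfrak T$ such that $\mathrm{Fix}\,T_{i,n}=C_i$ and set $a_{i,n}=T_{i,n}x_n$; for every $i\in I_n\cap K$,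 set $a_{i,n}=p_i+x_n-F_ix_n$; for every $i\in I_n$, set $\theta_{i,n}=\|a_{i,n}-x_n\|^2$; * take $j_n\in I_n$ such that $\theta_{j_n,n}=\max_{i\in I_n}\theta_{i,n}$, and take $\{\omega_{i,n}\}_{i\in I_n}\subset[0,1]$ such that $\sum_{i\in I_n}\omega_{i,n}=1$ and $\omega_{j_n,n}\geq\varepsilon$; * set $I_n^+=\{i\in I_n : \omega_{i,n}>0\}$ and $\theta_n=\sum_{i\in I_n^+}\omega_{i,n}\theta_{i,n}$; * if $\theta_n=0$, set $t_n=x_n$; otherwise set $y_n=\sum_{i\in I_n^+}\omega_{i,n}a_{i,n}-x_n$, take $\lambda_n\in\big[\varepsilon\theta_n/\|y_n\|^2,\ \theta_n/\|y_n\|^2\big]$, and set $t_n=x_n+\lambda_ny_n$; * set $x_{n+1}=Q(x_0,x_n,t_n)$. Suppose that the following hold: * **[d]** There exist strictly positive integers $(M_i)_{i\in J\cup K}$ such that, for every $i\in J\cup K$ and every $n\in\mathbb N$, $i\in\bigcup_{l=n}^{n+M_i-1}I_l$. * **[e]** For every $i\in J$, every $x\in\mathcal H$, and every strictly increasing sequence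 $(r_n)_{n\in\mathbb N}$ in $\mathbb N$: if $i\in\bigcap_{n\in\mathbb N}I_{r_n}$, $x_{r_n}\rightharpoonup x$ (weakly), and $T_{i,r_n}x_{r_n}-x_{r_n}\to 0$ (strongly), then $x\in C_i$. Then the algorithm is well defined, in the sense that $y_n\neq 0$ whenever $\theta_n\neq 0$ and $D(x_0,x_n,t_n)\neq\varnothing$ for every $n\in\mathbb N$; problem (P) has exactly one solution; and $(x_n)_{n\in\mathbb N}$ converges strongly to it. -/

import Mathlib

open Filter Topology

namespace BestApprox

variable {H : Type*} [NormedAddCommGroup H] [InnerProductSpace ℝ H]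

/-- Firmly nonexpansive operators. -/
def FirmlyNonexpansive (F : H → H) : Prop :=
  ∀ x y : H, ‖F x - F y‖ ^ 2 + ‖(x - F x) - (y - F y)‖ ^ 2 ≤ ‖x - y‖ ^ 2

/-- Firmly quasinonexpansive operators (the class `𝔗`). -/
def FirmlyQuasinonexpansive (T : H → H) : Prop :=
  ∀ x : H, ∀ y ∈ Function.fixedPoints T, inner ℝ (y - T x) (x - T x) ≤ 0

/-- Weak convergence of a sequence. -/
def WeaklyConverges (u : ℕ → H) (x : H) : Prop :=
  Tendsto (fun n => toWeakSpace ℝ H (u n)) atTop (𝓝 (toWeakSpace ℝ H x))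

/-- The feasible set: points of `⋂ j, C j` at which each `F k` takes the prescribed value `p k`. -/
def feasibleSet {J K : Type*} (C : J → Set H) (F : K → H → H) (p : K → H) : Set H :=
  {x | (∀ j, x ∈ C j) ∧ ∀ k, F k x = p k}

/-- `z` is a best approximation to `x₀` from `S`: it lies in `S` and minimizes `‖x - x₀‖` there. -/
def IsBestApprox (S : Set H) (x₀ z : H) : Prop :=
  z ∈ S ∧ IsMinOn (fun x => ‖x - x₀‖) S z

/-- The intersection of two half-spaces whose point nearest to `x₀` is `haugazeauQ x₀ s t`. -/
def haugazeauSet (x₀ s t : H) : Set H :=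
  {x | inner ℝ (x - s) (x₀ - s) ≤ 0 ∧ inner ℝ (x - t) (s - t) ≤ 0}

/-- Haugazeau's explicit formula. By Cauchy-Schwarz `ρ ≥ 0`; the remaining case
`ρ = 0 ∧ χ < 0` is exactly that of an empty `haugazeauSet x₀ s t`, where the value is arbitrary. -/
noncomputable def haugazeauQ (x₀ s t : H) : H :=
  let χ : ℝ := inner ℝ (x₀ - s) (s - t)
  let μ : ℝ := ‖x₀ - s‖ ^ 2
  let ν : ℝ := ‖s - t‖ ^ 2
  let ρ : ℝ := μ * ν - χ ^ 2
  if ρ = 0 then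
    if 0 ≤ χ then t else x₀
  else if ρ ≤ χ * ν then x₀ + (1 + χ / ν) • (t - s)
  else s + (ν / ρ) • (χ • (x₀ - s) + μ • (t - s))

/-- The sequences `x, I, T, a, η, j, ω, θ, y, lam, t` are produced by the block-iterative
algorithm started at `x₀`. The index set is the disjoint union `J ⊕ K`; `η i n` is the squared
displacement `‖a i n - x n‖ ^ 2`, `θ n` is its weighted average over the active block, and
`lam n` is the relaxation parameter. -/
structure IsAlgorithmRun {J K : Type*} (C : J → Set H) (F : K → H → H) (p : K → H) (x₀ : H)
    (ε : ℝ) (x : ℕ → H) (I : ℕ → Finset (J ⊕ K)) (T : J → ℕ → H → H) (a : J ⊕ K → ℕ → H)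
    (η : J ⊕ K → ℕ → ℝ) (j : ℕ → J ⊕ K) (ω : J ⊕ K → ℕ → ℝ) (θ : ℕ → ℝ) (y : ℕ → H)
    (lam : ℕ → ℝ) (t : ℕ → H) : Prop where
  init : x 0 = x₀
  block_nonempty : ∀ n, (I n).Nonempty
  op_mem : ∀ n i, Sum.inl i ∈ I n → FirmlyQuasinonexpansive (T i n)
  op_fix : ∀ n i, Sum.inl i ∈ I n → Function.fixedPoints (T i n) = C i
  a_inl : ∀ n i, Sum.inl i ∈ I n → a (Sum.inl i) n = T i n (x n)
  a_inr : ∀ n k, Sum.inr k ∈ I n → a (Sum.inr k) n = p k + x n - F k (x n)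
  eta_eq : ∀ n, ∀ i ∈ I n, η i n = ‖a i n - x n‖ ^ 2
  j_mem : ∀ n, j n ∈ I n
  j_max : ∀ n, ∀ i ∈ I n, η i n ≤ η (j n) n
  weight_mem : ∀ n, ∀ i ∈ I n, ω i n ∈ Set.Icc (0 : ℝ) 1
  weight_sum : ∀ n, ∑ i ∈ I n, ω i n = 1
  weight_j : ∀ n, ε ≤ ω (j n) n
  theta_eq : ∀ n, θ n = ∑ i ∈ I n with 0 < ω i n, ω i n * η i n
  t_of_eq : ∀ n, θ n = 0 → t n = x n
  y_of_ne : ∀ n, θ n ≠ 0 → y n = (∑ i ∈ I n with 0 < ω i n, ω i n • a i n) - x n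
  lam_of_ne : ∀ n, θ n ≠ 0 → lam n ∈ Set.Icc (ε * θ n / ‖y n‖ ^ 2) (θ n / ‖y n‖ ^ 2)
  t_of_ne : ∀ n, θ n ≠ 0 → t n = x n + lam n • y n
  step : ∀ n, x (n + 1) = haugazeauQ x₀ (x n) (t n)

end BestApprox

namespace BestApprox

variable {H : Type*} [NormedAddCommGroup H] [InnerProductSpace ℝ H]

/-! ### Weak sequential convergence in a Hilbert space -/

section WeakConvergence

/-! Averaging over the block the inequality `eta_le_inner`, valid at every feasible `z`, gives `θ n
≤ ⟪z - x n, y n⟫`. Since `lam n * ‖y n‖ ^ 2 ≤ θ n`, the half-space cut at `t n` contains the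
feasible set. By `haugazeauQ_spec`, `x (n + 1)` is the projection of `x₀` onto a set containing the
feasible set, and its variational inequality is the other half-space constraint of the next step, so
the inclusion propagates.

Hence `‖x n - x₀‖` increases and is bounded by `‖z - x₀‖`. The steps therefore vanish, which forces
`θ n` and the active displacements to zero. Bounded gaps between activations, condition [e] and
demiclosedness make weak cluster points feasible.

For feasible `z`, `‖x n - x₀‖ ^ 2 + ‖z - x n‖ ^ 2 ≤ ‖z - x₀‖ ^ 2`. Its inner product form upgrades
weak to strong subsequential convergence. In the limit it shows that every cluster point is the
unique minimizer, so existence comes with convergence. -/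

theorem weaklyConverges_iff [CompleteSpace H] {u : ℕ → H} {z : H} :
    WeaklyConverges u z ↔ ∀ w, Tendsto (fun n => inner ℝ (u n) w) atTop (𝓝 (inner ℝ z w)) := by
  have hinj : Function.Injective (topDualPairing ℝ H).flip := by
    intro v w h
    refine ext_inner_left ℝ fun a => ?_
    exact DFunLike.congr_fun h (InnerProductSpace.toDual ℝ H a)
  unfold WeaklyConverges
  refine (WeakBilin.tendsto_iff_forall_eval_tendsto (topDualPairing ℝ H).flip hinj).trans ?_
  constructor
  · intro h w
    have := h (InnerProductSpace.toDual ℝ H w)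
    simp_rw [real_inner_comm w]
    exact this
  · intro h f
    obtain ⟨w, rfl⟩ := (InnerProductSpace.toDual ℝ H).surjective f
    have := h w
    simp_rw [real_inner_comm w] at this
    exact this

/-- Bounded sequences of a Hilbert space have weakly convergent subsequences. -/
theorem exists_weaklyConverges_subseq [CompleteSpace H] {u : ℕ → H} {B : ℝ}
    (hB : ∀ n, ‖u n‖ ≤ B) : ∃ z, ∃ φ : ℕ → ℕ, StrictMono φ ∧
      WeaklyConverges (fun n => u (φ n)) z := by
  -- The closed span of the sequence is separable, so closed balls of its dual are weak-*
  -- sequentially compact.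
  let V : Submodule ℝ H := (Submodule.span ℝ (Set.range u)).topologicalClosure
  have hV : IsClosed (V : Set H) := Submodule.isClosed_topologicalClosure _
  have : CompleteSpace V := hV.completeSpace_coe
  have : TopologicalSpace.SeparableSpace V := by
    have h : TopologicalSpace.IsSeparable (V : Set H) := by
      rw [Submodule.topologicalClosure_coe]
      exact ((Set.countable_range u).isSeparable.span (R := ℝ)).closure
    exact h.separableSpace
  have hu : ∀ n, u n ∈ V := fun n =>
    Submodule.le_topologicalClosure _ (Submodule.subset_span ⟨n, rfl⟩)
  let v : ℕ → V := fun n => ⟨u n, hu n⟩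
  have hmem : ∀ n, StrongDual.toWeakDual (InnerProductSpace.toDual ℝ V (v n)) ∈
      WeakDual.toStrongDual ⁻¹' Metric.closedBall (0 : StrongDual ℝ V) B := by
    intro n
    rw [Set.mem_preimage]
    exact mem_closedBall_zero_iff.2 <| ((InnerProductSpace.toDual ℝ V).norm_map (v n)).le.trans (hB n)
  obtain ⟨f, -, φ, hφ, hf⟩ := WeakDual.isSeqCompact_closedBall ℝ V 0 B hmem
  obtain ⟨z, hz⟩ := (InnerProductSpace.toDual ℝ V).surjective (WeakDual.toStrongDual f)
  refine ⟨z, φ, hφ, weaklyConverges_iff.2 fun w => ?_⟩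
  have h := (WeakDual.eval_continuous (V.orthogonalProjectionOnto w)).continuousAt.tendsto.comp hf
  have hproj : ∀ a : V, inner ℝ (a : H) w = inner ℝ a (V.orthogonalProjectionOnto w) := by
    intro a
    rw [real_inner_comm, real_inner_comm (V.orthogonalProjectionOnto w)]
    exact (Submodule.inner_orthogonalProjectionOnto_eq_of_mem_right a w).symm
  have h2 : f (V.orthogonalProjectionOnto w) = inner ℝ (z : H) w := by
    rw [hproj, ← InnerProductSpace.toDual_apply_apply (𝕜 := ℝ), hz]
    rfl
  rw [← h2]
  refine h.congr fun n => ?_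
  exact (hproj (v (φ n))).symm

/-- A weak limit is not affected by a perturbation that tends strongly to zero. -/
theorem WeaklyConverges.of_sub_tendsto_zero [CompleteSpace H] {u v : ℕ → H} {z : H}
    (hu : WeaklyConverges u z) (h : Tendsto (fun n => v n - u n) atTop (𝓝 0)) :
    WeaklyConverges v z := by
  rw [weaklyConverges_iff] at hu ⊢
  intro w
  have h1 : Tendsto (fun n => inner ℝ (v n - u n) w) atTop (𝓝 (inner ℝ (0 : H) w)) :=
    h.inner tendsto_const_nhds
  simpa [inner_sub_left] using h1.add (hu w)

theorem WeaklyConverges.comp_strictMono [CompleteSpace H] {u : ℕ → H} {z : H}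
    (hu : WeaklyConverges u z) {φ : ℕ → ℕ} (hφ : StrictMono φ) :
    WeaklyConverges (fun n => u (φ n)) z :=
  weaklyConverges_iff.2 fun w => (weaklyConverges_iff.1 hu w).comp hφ.tendsto_atTop

end WeakConvergence

/-! ### Firmly nonexpansive operators -/

section Operators

theorem FirmlyNonexpansive.norm_sq_le_inner {F : H → H} (hF : FirmlyNonexpansive F) (x y : H) :
    ‖F x - F y‖ ^ 2 ≤ inner ℝ (x - y) (F x - F y) := by
  have h := hF x y
  have e : (x - F x) - (y - F y) = (x - y) - (F x - F y) := by abel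
  rw [e, norm_sub_sq_real (x - y)] at h
  linarith

/-- Demiclosedness of a firmly nonexpansive operator along a sequence whose images converge. -/
theorem FirmlyNonexpansive.eq_of_weaklyConverges [CompleteSpace H] {F : H → H}
    (hF : FirmlyNonexpansive F) {u : ℕ → H} {z q : H} {B : ℝ} (hB : ∀ n, ‖u n - z‖ ≤ B)
    (hu : WeaklyConverges u z) (h : Tendsto (fun n => F (u n)) atTop (𝓝 q)) : F z = q := by
  have h1 : Tendsto (fun n => B * ‖F (u n) - q‖) atTop (𝓝 0) := by
    simpa using (tendsto_iff_norm_sub_tendsto_zero.1 h).const_mul B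
  have h2 : Tendsto (fun n => inner ℝ (u n - z) (q - F z)) atTop (𝓝 0) := by
    have := (weaklyConverges_iff.1 hu (q - F z)).sub_const (inner ℝ z (q - F z))
    simpa [inner_sub_left] using this
  -- The bound `⟪u n - z, F (u n) - F z⟫` splits at `q` into a bounded factor against a strongly
  -- null one, and a weakly null factor against a fixed vector.
  have h3 : Tendsto (fun n => ‖F (u n) - F z‖ ^ 2) atTop (𝓝 0) := by
    refine squeeze_zero (fun _ => by positivity) (fun n => ?_) (by simpa using h1.add h2)
    have e : F (u n) - F z = (F (u n) - q) + (q - F z) := by abel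
    have h5 := hF.norm_sq_le_inner (u n) z
    have h6 : inner ℝ (u n - z) (F (u n) - F z) =
        inner ℝ (u n - z) (F (u n) - q) + inner ℝ (u n - z) (q - F z) := by
      rw [← inner_add_right, ← e]
    have h7 := real_inner_le_norm (u n - z) (F (u n) - q)
    have h8 := mul_le_mul_of_nonneg_right (hB n) (norm_nonneg (F (u n) - q))
    linarith
  have h4 : Tendsto (fun n => ‖F (u n) - F z‖ ^ 2) atTop (𝓝 (‖q - F z‖ ^ 2)) :=
    (h.sub_const _).norm.pow 2
  have := tendsto_nhds_unique h4 h3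
  exact (sub_eq_zero.1 (by simpa using this)).symm

end Operators

/-! ### Projection onto the intersection of two half-spaces -/

section Haugazeau

/-- Haugazeau's formula gives the projection of `x₀` onto the intersection of the half-spaces. -/
theorem haugazeauQ_spec {x₀ s t : H} (hne : (haugazeauSet x₀ s t).Nonempty) :
    haugazeauQ x₀ s t ∈ haugazeauSet x₀ s t ∧
      ∀ z ∈ haugazeauSet x₀ s t,
        inner ℝ (z - haugazeauQ x₀ s t) (x₀ - haugazeauQ x₀ s t) ≤ 0 := by
  obtain ⟨u, rfl⟩ : ∃ u, x₀ = s + u := ⟨x₀ - s, by abel⟩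
  obtain ⟨v, rfl⟩ : ∃ v, t = s - v := ⟨s - t, by abel⟩
  have es : ∀ z, inner ℝ (z - s) (s + u - s) = inner ℝ (z - s) u := by intro z; simp
  have et : ∀ z, inner ℝ (z - (s - v)) (s - (s - v)) = inner ℝ (z - s) v + ‖v‖ ^ 2 := by
    intro z
    rw [sub_sub_cancel, ← real_inner_self_eq_norm_sq, ← inner_add_left]
    congr 1; abel
  have hmem : ∀ z, z ∈ haugazeauSet (s + u) s (s - v) ↔
      inner ℝ (z - s) u ≤ 0 ∧ inner ℝ (z - s) v + ‖v‖ ^ 2 ≤ 0 := by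
    intro z
    simp only [haugazeauSet, Set.mem_ofPred_eq, es, et]
  simp only [hmem]
  have hcs : inner ℝ u v ^ 2 ≤ ‖u‖ ^ 2 * ‖v‖ ^ 2 := by
    rw [← mul_pow, sq_le_sq, abs_of_nonneg (by positivity : 0 ≤ ‖u‖ * ‖v‖)]
    exact abs_real_inner_le_norm u v
  have hq : haugazeauQ (s + u) s (s - v) =
      if ‖u‖ ^ 2 * ‖v‖ ^ 2 - inner ℝ u v ^ 2 = 0 then
        if 0 ≤ inner ℝ u v then s - v else s + u
      else if ‖u‖ ^ 2 * ‖v‖ ^ 2 - inner ℝ u v ^ 2 ≤ inner ℝ u v * ‖v‖ ^ 2 then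
        s + u + (1 + inner ℝ u v / ‖v‖ ^ 2) • (-v)
      else s + (‖v‖ ^ 2 / (‖u‖ ^ 2 * ‖v‖ ^ 2 - inner ℝ u v ^ 2)) •
        (inner ℝ u v • u + ‖u‖ ^ 2 • (-v)) := by
    simp [haugazeauQ]
  rw [hq]
  have huu : inner ℝ u u = ‖u‖ ^ 2 := real_inner_self_eq_norm_sq u
  have hvv : inner ℝ v v = ‖v‖ ^ 2 := real_inner_self_eq_norm_sq v
  have hvu : inner ℝ v u = inner ℝ u v := real_inner_comm _ _
  generalize hχ : inner ℝ u v = χ at *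
  generalize hμ : ‖u‖ ^ 2 = μ at *
  generalize hν : ‖v‖ ^ 2 = ν at *
  have hμ0 : 0 ≤ μ := hμ ▸ sq_nonneg _
  have hν0 : 0 ≤ ν := hν ▸ sq_nonneg _
  -- In order: degenerate Gram determinant with `χ ≥ 0`, the empty intersection, only the second
  -- constraint needed as multiplier, and both constraints active.
  split_ifs with h1 h2 h3
  · have hzv : ∀ z : H, inner ℝ (z - (s - v)) u = inner ℝ (z - s) u + χ := by
      intro z
      rw [← hvu, ← inner_add_left]; congr 1; abel
    refine ⟨⟨?_, ?_⟩, fun z hz => ?_⟩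
    · simp [inner_neg_left, hvu, h2]
    · simp [hν]
    · have e : inner ℝ (z - (s - v)) (s + u - (s - v)) =
          inner ℝ (z - s) u + χ + (inner ℝ (z - s) v + ν) := by
        rw [← hzv, ← hvv, ← inner_add_left, show z - s + v = z - (s - v) by abel,
          ← inner_add_right]
        congr 1; abel
      rw [e]
      rcases hν0.eq_or_lt with h0 | h0
      · have hv : v = 0 := by
          rw [← norm_eq_zero, ← sq_eq_zero_iff, hν, ← h0]
        have : χ = 0 := by rw [← hχ, hv, inner_zero_right]
        linarith [hz.1, hz.2]
      -- Equality in Cauchy-Schwarz: `‖ν • u - χ • v‖ ^ 2 = ν * (μ * ν - χ ^ 2)`.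
      · have hu : ν • u = χ • v := by
          rw [← sub_eq_zero, ← norm_eq_zero, ← sq_eq_zero_iff, ← real_inner_self_eq_norm_sq]
          simp only [inner_sub_left, inner_sub_right, real_inner_smul_left,
            real_inner_smul_right, huu, hvv, hvu, hχ]
          linear_combination ν * h1
        have h4 : ν * inner ℝ (z - s) u = χ * inner ℝ (z - s) v := by
          rw [← real_inner_smul_right, hu, real_inner_smul_right]
        have h5 : ν * (inner ℝ (z - s) u + χ) ≤ 0 := by
          have := mul_nonneg h2 (neg_nonneg.2 hz.2)
          nlinarith
        have := nonpos_of_mul_nonpos_right h5 h0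
        linarith [hz.2]
  · exfalso
    obtain ⟨z, hz⟩ := hne
    rw [hmem] at hz
    have hν' : 0 < ν := by
      rcases hν0.eq_or_lt with h0 | h0
      · rw [← h0] at h1; nlinarith
      · exact h0
    have hu : ν • u = χ • v := by
      rw [← sub_eq_zero, ← norm_eq_zero, ← sq_eq_zero_iff, ← real_inner_self_eq_norm_sq]
      simp only [inner_sub_left, inner_sub_right, real_inner_smul_left,
        real_inner_smul_right, huu, hvv, hvu, hχ]
      linear_combination ν * h1
    have h4 : ν * inner ℝ (z - s) u = χ * inner ℝ (z - s) v := by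
      rw [← real_inner_smul_right, hu, real_inner_smul_right]
    have h5 : ν * inner ℝ (z - s) u ≤ 0 := mul_nonpos_of_nonneg_of_nonpos hν0 hz.1
    have h6 : 0 < χ * inner ℝ (z - s) v := mul_pos_of_neg_of_neg (not_le.1 h2) (by linarith [hz.2])
    linarith
  · have hρ : 0 < μ * ν - χ ^ 2 := lt_of_le_of_ne (by linarith) (Ne.symm h1)
    have hν' : 0 < ν := by
      rcases hν0.eq_or_lt with h0 | h0
      · rw [← h0] at hρ; nlinarith
      · exact h0
    have hχ' : 0 < χ := pos_of_mul_pos_left (hρ.trans_le h3) hν0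
    have hqs : s + u + (1 + χ / ν) • (-v) - s = u - (1 + χ / ν) • v := by
      rw [smul_neg]; abel
    refine ⟨⟨?_, ?_⟩, fun z hz => ?_⟩
    · rw [hqs, inner_sub_left, real_inner_smul_left, huu, hvu]
      have : ν * (μ - (1 + χ / ν) * χ) ≤ 0 := by
        have : ν * (μ - (1 + χ / ν) * χ) = μ * ν - χ ^ 2 - χ * ν := by field_simp; ring
        linarith
      exact nonpos_of_mul_nonpos_right this hν'
    · rw [hqs, inner_sub_left, real_inner_smul_left, hvv, hχ]
      apply le_of_eq; field_simp; ring
    · have e1 : s + u - (s + u + (1 + χ / ν) • (-v)) = (1 + χ / ν) • v := by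
        rw [smul_neg]; abel
      have e2 : z - (s + u + (1 + χ / ν) • (-v)) = (z - s) - (u - (1 + χ / ν) • v) := by
        rw [smul_neg]; abel
      rw [e1, e2, real_inner_smul_right]
      refine mul_nonpos_of_nonneg_of_nonpos (by positivity) ?_
      rw [inner_sub_left, inner_sub_left u, real_inner_smul_left, hvv, hχ]
      have : (1 + χ / ν) * ν = ν + χ := by field_simp
      linarith [hz.2]
  · have hρ : 0 < μ * ν - χ ^ 2 := lt_of_le_of_ne (by linarith) (Ne.symm h1)
    generalize hr : μ * ν - χ ^ 2 = ρ at *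
    have hqs : s + (ν / ρ) • (χ • u + μ • (-v)) - s = (ν / ρ) • (χ • u - μ • v) := by
      rw [smul_neg, ← sub_eq_add_neg]; abel
    have hu0 : inner ℝ ((ν / ρ) • (χ • u - μ • v)) u = 0 := by
      simp only [inner_sub_left, real_inner_smul_left, huu, hvu]; ring
    have hv0 : inner ℝ ((ν / ρ) • (χ • u - μ • v)) v + ν = 0 := by
      simp only [inner_sub_left, real_inner_smul_left, hvv, hχ]
      field_simp
      linear_combination (-ν) * hr
    rw [hqs]
    refine ⟨⟨hu0.le, hv0.le⟩, fun z hz => ?_⟩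
    have e1 : s + u - (s + (ν / ρ) • (χ • u + μ • (-v))) =
        (1 - ν * χ / ρ) • u + (ν * μ / ρ) • v := by
      module
    have e2 : z - (s + (ν / ρ) • (χ • u + μ • (-v))) =
        (z - s) - (ν / ρ) • (χ • u - μ • v) := by module
    rw [e1, e2, inner_add_right, real_inner_smul_right, real_inner_smul_right,
      inner_sub_left _ _ u, inner_sub_left _ _ v, hu0]
    -- Nonnegative multipliers for the two constraints; the first is where `χ * ν < ρ` enters.
    have c1 : 0 ≤ 1 - ν * χ / ρ := by
      rw [sub_nonneg, div_le_one hρ]; linarith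
    have c2 : 0 ≤ ν * μ / ρ := by positivity
    have := mul_nonpos_of_nonneg_of_nonpos c1 hz.1
    have := mul_nonpos_of_nonneg_of_nonpos c2 hz.2
    rw [sub_zero, eq_neg_of_add_eq_zero_left hv0, sub_neg_eq_add]
    linarith

end Haugazeau

end BestApprox

namespace BestApprox

variable {H : Type*} [NormedAddCommGroup H] [InnerProductSpace ℝ H]

/-! ### One block step: half-space cuts and displacement estimates -/

namespace IsAlgorithmRun

variable {J K : Type*} {C : J → Set H} {F : K → H → H} {p : K → H} {x₀ : H}
  {ε : ℝ} {x : ℕ → H} {I : ℕ → Finset (J ⊕ K)} {T : J → ℕ → H → H} {a : J ⊕ K → ℕ → H}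
  {η : J ⊕ K → ℕ → ℝ} {j : ℕ → J ⊕ K} {ω : J ⊕ K → ℕ → ℝ} {θ : ℕ → ℝ} {y : ℕ → H}
  {lam : ℕ → ℝ} {t : ℕ → H}

theorem eta_nonneg (h : IsAlgorithmRun C F p x₀ ε x I T a η j ω θ y lam t) {n : ℕ}
    {i : J ⊕ K} (hi : i ∈ I n) : 0 ≤ η i n := by
  rw [h.eta_eq n i hi]; positivity

/-- For `J` this is firm quasinonexpansiveness at a fixed point; for `K` it is `norm_sq_le_inner`,
because `a i n - x n = p k - F k (x n)`. -/
theorem eta_le_inner (h : IsAlgorithmRun C F p x₀ ε x I T a η j ω θ y lam t)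
    (hF : ∀ k, FirmlyNonexpansive (F k)) {z : H} (hz : z ∈ feasibleSet C F p) {n : ℕ}
    {i : J ⊕ K} (hi : i ∈ I n) : η i n ≤ inner ℝ (z - x n) (a i n - x n) := by
  rw [h.eta_eq n i hi]
  rcases i with i | k
  · rw [h.a_inl n i hi]
    have hfix : z ∈ Function.fixedPoints (T i n) := by
      rw [h.op_fix n i hi]; exact hz.1 i
    have h1 := h.op_mem n i hi (x n) z hfix
    have e1 : z - T i n (x n) = (z - x n) - (T i n (x n) - x n) := by abel
    rw [e1, ← neg_sub (T i n (x n)), inner_neg_right, inner_sub_left,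
      real_inner_self_eq_norm_sq] at h1
    linarith
  · rw [h.a_inr n k hi]
    have h1 := (hF k).norm_sq_le_inner (x n) z
    rw [hz.2 k] at h1
    have e1 : p k + x n - F k (x n) - x n = -(F k (x n) - p k) := by abel
    rw [e1, norm_neg, ← neg_sub (x n) z, inner_neg_neg]
    exact h1

theorem theta_eq_sum (h : IsAlgorithmRun C F p x₀ ε x I T a η j ω θ y lam t) (n : ℕ) :
    θ n = ∑ i ∈ I n, ω i n * η i n := by
  rw [h.theta_eq n]
  refine Finset.sum_filter_of_ne fun i hi hne => ?_
  exact lt_of_le_of_ne (h.weight_mem n i hi).1 fun h0 => hne (by rw [← h0, zero_mul])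

theorem y_eq_sum (h : IsAlgorithmRun C F p x₀ ε x I T a η j ω θ y lam t) {n : ℕ}
    (hn : θ n ≠ 0) : y n = ∑ i ∈ I n, ω i n • (a i n - x n) := by
  have h1 : ∑ i ∈ I n with 0 < ω i n, ω i n • a i n = ∑ i ∈ I n, ω i n • a i n := by
    refine Finset.sum_filter_of_ne fun i hi hne => ?_
    exact lt_of_le_of_ne (h.weight_mem n i hi).1 fun h0 => hne (by rw [← h0, zero_smul])
  simp_rw [smul_sub]
  rw [h.y_of_ne n hn, h1, Finset.sum_sub_distrib, ← Finset.sum_smul, h.weight_sum, one_smul]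

theorem theta_nonneg (h : IsAlgorithmRun C F p x₀ ε x I T a η j ω θ y lam t) (n : ℕ) :
    0 ≤ θ n := by
  rw [h.theta_eq_sum n]
  exact Finset.sum_nonneg fun i hi => mul_nonneg (h.weight_mem n i hi).1 (h.eta_nonneg hi)

/-- The largest displacement carries weight at least `ε`, so `θ n` controls even the indices of
weight zero. -/
theorem mul_eta_le_theta (h : IsAlgorithmRun C F p x₀ ε x I T a η j ω θ y lam t) (hε : 0 ≤ ε)
    {n : ℕ} {i : J ⊕ K} (hi : i ∈ I n) : ε * η i n ≤ θ n := by
  have h1 : ε * η i n ≤ ω (j n) n * η (j n) n :=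
    mul_le_mul (h.weight_j n) (h.j_max n i hi) (h.eta_nonneg hi) (hε.trans (h.weight_j n))
  refine h1.trans ?_
  rw [h.theta_eq_sum n]
  exact Finset.single_le_sum (f := fun i => ω i n * η i n)
    (fun i hi => mul_nonneg (h.weight_mem n i hi).1 (h.eta_nonneg hi)) (h.j_mem n)

theorem norm_y_sq_le (h : IsAlgorithmRun C F p x₀ ε x I T a η j ω θ y lam t) {n : ℕ}
    (hn : θ n ≠ 0) : ‖y n‖ ^ 2 ≤ θ n := by
  have hconv : ConvexOn ℝ Set.univ (fun v : H => ‖v‖ ^ 2) :=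
    convexOn_univ_norm.pow (fun _ _ => norm_nonneg _) 2
  rw [h.y_eq_sum hn, h.theta_eq_sum n]
  refine (hconv.map_sum_le (fun i hi => (h.weight_mem n i hi).1) (h.weight_sum n)
    (fun _ _ => Set.mem_univ _)).trans (le_of_eq ?_)
  exact Finset.sum_congr rfl fun i hi => by rw [h.eta_eq n i hi, smul_eq_mul]

theorem theta_le_inner (h : IsAlgorithmRun C F p x₀ ε x I T a η j ω θ y lam t)
    (hF : ∀ k, FirmlyNonexpansive (F k)) {z : H} (hz : z ∈ feasibleSet C F p) {n : ℕ}
    (hn : θ n ≠ 0) : θ n ≤ inner ℝ (z - x n) (y n) := by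
  rw [h.y_eq_sum hn, h.theta_eq_sum n, inner_sum]
  refine Finset.sum_le_sum fun i hi => ?_
  rw [real_inner_smul_right]
  exact mul_le_mul_of_nonneg_left (h.eta_le_inner hF hz hi) (h.weight_mem n i hi).1

theorem y_ne_zero (h : IsAlgorithmRun C F p x₀ ε x I T a η j ω θ y lam t)
    (hF : ∀ k, FirmlyNonexpansive (F k)) {z : H} (hz : z ∈ feasibleSet C F p) {n : ℕ}
    (hn : θ n ≠ 0) : y n ≠ 0 := by
  intro h0
  have h1 := h.theta_le_inner hF hz hn
  rw [h0, inner_zero_right] at h1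
  exact hn (le_antisymm h1 (h.theta_nonneg n))

/-- Feasible points belong to the half-space cut by the block step. -/
theorem inner_sub_t_nonpos (h : IsAlgorithmRun C F p x₀ ε x I T a η j ω θ y lam t)
    (hF : ∀ k, FirmlyNonexpansive (F k)) (hε : 0 ≤ ε) {z : H} (hz : z ∈ feasibleSet C F p)
    (n : ℕ) : inner ℝ (z - t n) (x n - t n) ≤ 0 := by
  by_cases hn : θ n = 0
  · rw [h.t_of_eq n hn, sub_self, inner_zero_right]
  have hy : 0 < ‖y n‖ ^ 2 := by
    have := norm_pos_iff.2 (h.y_ne_zero hF hz hn); positivity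
  have hl := h.lam_of_ne n hn
  have hl0 : 0 ≤ lam n :=
    le_trans (div_nonneg (mul_nonneg hε (h.theta_nonneg n)) hy.le) hl.1
  have hl1 : lam n * ‖y n‖ ^ 2 ≤ θ n := (le_div_iff₀ hy).1 hl.2
  have h1 := h.theta_le_inner hF hz hn
  have e1 : z - t n = (z - x n) - lam n • y n := by rw [h.t_of_ne n hn]; abel
  have e2 : x n - t n = -(lam n • y n) := by rw [h.t_of_ne n hn]; abel
  rw [e1, e2, inner_neg_right, inner_sub_left, real_inner_smul_right, real_inner_smul_right,
    real_inner_smul_left, real_inner_self_eq_norm_sq]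
  have := mul_nonneg hl0 (sub_nonneg.2 (hl1.trans h1))
  linarith

/-- The lower bound on `lam n` gives `‖t n - x n‖ * ‖y n‖ ≥ ε * θ n`, and `‖y n‖ ^ 2 ≤ θ n` by
convexity. -/
theorem sq_mul_theta_le (h : IsAlgorithmRun C F p x₀ ε x I T a η j ω θ y lam t)
    (hF : ∀ k, FirmlyNonexpansive (F k)) (hε : 0 ≤ ε) {z : H} (hz : z ∈ feasibleSet C F p)
    (n : ℕ) : ε ^ 2 * θ n ≤ ‖t n - x n‖ ^ 2 := by
  by_cases hn : θ n = 0
  · rw [hn, mul_zero]; positivity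
  have hy : 0 < ‖y n‖ ^ 2 := by
    have := norm_pos_iff.2 (h.y_ne_zero hF hz hn); positivity
  have hθ := h.theta_nonneg n
  have hl : ε * θ n ≤ lam n * ‖y n‖ ^ 2 := (div_le_iff₀ hy).1 (h.lam_of_ne n hn).1
  rw [h.t_of_ne n hn, add_sub_cancel_left, norm_smul, mul_pow, Real.norm_eq_abs, sq_abs]
  refine le_of_mul_le_mul_right ?_ hy
  calc ε ^ 2 * θ n * ‖y n‖ ^ 2 ≤ ε ^ 2 * θ n * θ n := by
        gcongr; exact h.norm_y_sq_le hn
    _ = (ε * θ n) ^ 2 := by ring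
    _ ≤ (lam n * ‖y n‖ ^ 2) ^ 2 := by gcongr
    _ = lam n ^ 2 * ‖y n‖ ^ 2 * ‖y n‖ ^ 2 := by ring

/-- The feasible set is contained in every Haugazeau set generated by the algorithm. -/
theorem feasibleSet_subset (h : IsAlgorithmRun C F p x₀ ε x I T a η j ω θ y lam t)
    (hF : ∀ k, FirmlyNonexpansive (F k)) (hε : 0 ≤ ε) (n : ℕ) :
    feasibleSet C F p ⊆ haugazeauSet x₀ (x n) (t n) := by
  induction n with
  | zero =>
    exact fun z hz => ⟨by rw [h.init, sub_self, inner_zero_right], h.inner_sub_t_nonpos hF hε hz 0⟩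
  | succ n ih =>
    refine fun z hz => ⟨?_, h.inner_sub_t_nonpos hF hε hz _⟩
    rw [h.step n]
    exact (haugazeauQ_spec ⟨z, ih hz⟩).2 z (ih hz)

theorem norm_sq_sub_add_le (h : IsAlgorithmRun C F p x₀ ε x I T a η j ω θ y lam t)
    (hF : ∀ k, FirmlyNonexpansive (F k)) (hε : 0 ≤ ε) {z : H} (hz : z ∈ feasibleSet C F p)
    (n : ℕ) : ‖x n - x₀‖ ^ 2 + ‖z - x n‖ ^ 2 ≤ ‖z - x₀‖ ^ 2 := by
  have h1 := (h.feasibleSet_subset hF hε n hz).1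
  have e : z - x₀ = (z - x n) - (x₀ - x n) := by abel
  rw [e, norm_sub_sq_real (z - x n), norm_sub_rev (x n)]
  linarith

theorem next_mem (h : IsAlgorithmRun C F p x₀ ε x I T a η j ω θ y lam t)
    (hF : ∀ k, FirmlyNonexpansive (F k)) (hε : 0 ≤ ε) {z : H} (hz : z ∈ feasibleSet C F p)
    (n : ℕ) : x (n + 1) ∈ haugazeauSet x₀ (x n) (t n) := by
  rw [h.step n]
  exact (haugazeauQ_spec ⟨z, h.feasibleSet_subset hF hε n hz⟩).1

/-! ### Asymptotic regularity and cluster points -/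

theorem tendsto_step (h : IsAlgorithmRun C F p x₀ ε x I T a η j ω θ y lam t)
    (hF : ∀ k, FirmlyNonexpansive (F k)) (hε : 0 ≤ ε) {z : H} (hz : z ∈ feasibleSet C F p) :
    Tendsto (fun n => ‖x (n + 1) - x n‖ ^ 2) atTop (𝓝 0) := by
  have hstep : ∀ n, ‖x n - x₀‖ ^ 2 + ‖x (n + 1) - x n‖ ^ 2 ≤ ‖x (n + 1) - x₀‖ ^ 2 := by
    intro n
    have h1 := (h.next_mem hF hε hz n).1
    have e : x (n + 1) - x₀ = (x (n + 1) - x n) - (x₀ - x n) := by abel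
    rw [e, norm_sub_sq_real (x (n + 1) - x n), norm_sub_rev (x n)]
    linarith
  have hmono : Monotone fun n => ‖x n - x₀‖ ^ 2 :=
    monotone_nat_of_le_succ fun n => by linarith [hstep n, sq_nonneg ‖x (n + 1) - x n‖]
  have hbdd : BddAbove (Set.range fun n => ‖x n - x₀‖ ^ 2) := by
    refine ⟨‖z - x₀‖ ^ 2, ?_⟩
    rintro _ ⟨n, rfl⟩
    linarith [h.norm_sq_sub_add_le hF hε hz n, sq_nonneg ‖z - x n‖]
  have hlim := tendsto_atTop_ciSup hmono hbdd
  have hdiff := (hlim.comp (tendsto_add_atTop_nat 1)).sub hlim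
  rw [sub_self] at hdiff
  exact squeeze_zero (fun n => by positivity)
    (fun n => by simpa using (by linarith [hstep n] :
      ‖x (n + 1) - x n‖ ^ 2 ≤ ‖x (n + 1) - x₀‖ ^ 2 - ‖x n - x₀‖ ^ 2)) hdiff

theorem tendsto_sub_next (h : IsAlgorithmRun C F p x₀ ε x I T a η j ω θ y lam t)
    (hF : ∀ k, FirmlyNonexpansive (F k)) (hε : 0 ≤ ε) {z : H} (hz : z ∈ feasibleSet C F p) :
    Tendsto (fun n => x (n + 1) - x n) atTop (𝓝 0) := by
  rw [tendsto_zero_iff_norm_tendsto_zero]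
  simpa using (h.tendsto_step hF hε hz).sqrt

theorem tendsto_sub_add (h : IsAlgorithmRun C F p x₀ ε x I T a η j ω θ y lam t)
    (hF : ∀ k, FirmlyNonexpansive (F k)) (hε : 0 ≤ ε) {z : H} (hz : z ∈ feasibleSet C F p)
    (m : ℕ) : Tendsto (fun n => x (n + m) - x n) atTop (𝓝 0) := by
  induction m with
  | zero => simp
  | succ m ih =>
    have h1 := (h.tendsto_sub_next hF hε hz).comp (tendsto_add_atTop_nat m)
    have h2 := h1.add ih
    rw [add_zero] at h2
    refine h2.congr fun n => ?_
    simp only [Function.comp_apply, ← add_assoc]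
    abel

theorem tendsto_theta (h : IsAlgorithmRun C F p x₀ ε x I T a η j ω θ y lam t)
    (hF : ∀ k, FirmlyNonexpansive (F k)) (hε : 0 < ε) {z : H} (hz : z ∈ feasibleSet C F p) :
    Tendsto θ atTop (𝓝 0) := by
  have hle : ∀ n, θ n ≤ (ε ^ 2)⁻¹ * ‖x (n + 1) - x n‖ ^ 2 := by
    intro n
    rw [← div_eq_inv_mul, le_div_iff₀ (by positivity), mul_comm]
    refine (h.sq_mul_theta_le hF hε.le hz n).trans ?_
    -- As `x (n + 1)` lies beyond the cut at `t n`, the angle at `t n` is obtuse and `‖t n - x n‖ ≤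
    -- ‖x (n + 1) - x n‖`.
    have h1 := (h.next_mem hF hε.le hz n).2
    have e : x (n + 1) - x n = (x (n + 1) - t n) - (x n - t n) := by abel
    rw [e, norm_sub_sq_real (x (n + 1) - t n), norm_sub_rev (t n)]
    linarith [sq_nonneg ‖x (n + 1) - t n‖]
  refine squeeze_zero h.theta_nonneg hle ?_
  simpa using (h.tendsto_step hF hε.le hz).const_mul (ε ^ 2)⁻¹

theorem tendsto_displacement (h : IsAlgorithmRun C F p x₀ ε x I T a η j ω θ y lam t)
    (hF : ∀ k, FirmlyNonexpansive (F k)) (hε : 0 < ε) {z : H} (hz : z ∈ feasibleSet C F p)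
    {i : J ⊕ K} {r : ℕ → ℕ} (hr : StrictMono r) (hi : ∀ n, i ∈ I (r n)) :
    Tendsto (fun n => a i (r n) - x (r n)) atTop (𝓝 0) := by
  have h1 : Tendsto (fun n => ‖a i (r n) - x (r n)‖ ^ 2) atTop (𝓝 0) := by
    have h2 := ((h.tendsto_theta hF hε hz).comp hr.tendsto_atTop).const_mul ε⁻¹
    rw [mul_zero] at h2
    refine squeeze_zero (fun n => by positivity) (fun n => ?_) h2
    rw [← h.eta_eq _ _ (hi n), ← div_eq_inv_mul, le_div_iff₀ hε, mul_comm]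
    exact h.mul_eta_le_theta hε.le (hi n)
  rw [tendsto_zero_iff_norm_tendsto_zero]
  simpa using h1.sqrt

/-- Every weak sequential cluster point of the iterates is feasible. -/
theorem mem_feasibleSet_of_weaklyConverges [CompleteSpace H]
    (h : IsAlgorithmRun C F p x₀ ε x I T a η j ω θ y lam t)
    (hF : ∀ k, FirmlyNonexpansive (F k)) (hε : 0 < ε) (hne : (feasibleSet C F p).Nonempty)
    (hd : ∃ M : J ⊕ K → ℕ, (∀ i, 0 < M i) ∧ ∀ i n, ∃ l ∈ Set.Ico n (n + M i), i ∈ I l)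
    (he : ∀ (i : J) (z : H) (r : ℕ → ℕ), StrictMono r →
      (∀ n, Sum.inl i ∈ I (r n)) →
      WeaklyConverges (fun n => x (r n)) z →
      Tendsto (fun n => T i (r n) (x (r n)) - x (r n)) atTop (𝓝 0) →
      z ∈ C i)
    {φ : ℕ → ℕ} (hφ : StrictMono φ) {z : H} (hz : WeaklyConverges (fun n => x (φ n)) z) :
    z ∈ feasibleSet C F p := by
  obtain ⟨s, hs⟩ := hne
  have key : ∀ i : J ⊕ K, ∃ r : ℕ → ℕ, StrictMono r ∧ (∀ n, i ∈ I (r n)) ∧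
      WeaklyConverges (fun n => x (r n)) z := by
    intro i
    obtain ⟨M, -, hM⟩ := hd
    -- `l n` is an activation time of `i` fewer than `M i` steps after `φ n`. The varying gap is
    -- handled by summing over all gaps below `M i`.
    choose l hl hil using fun n => hM i (φ n)
    have hle : ∀ n, φ n ≤ l n := fun n => (hl n).1
    have hltop : Tendsto l atTop atTop := tendsto_atTop_mono hle hφ.tendsto_atTop
    have hdiff : Tendsto (fun n => x (l n) - x (φ n)) atTop (𝓝 0) := by
      rw [tendsto_zero_iff_norm_tendsto_zero]
      have h1 : Tendsto (fun n => ∑ m ∈ Finset.range (M i), ‖x (φ n + m) - x (φ n)‖)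
          atTop (𝓝 0) := by
        have := tendsto_finsetSum (Finset.range (M i)) fun m _ =>
          ((h.tendsto_sub_add hF hε.le hs m).comp hφ.tendsto_atTop).norm
        simpa using this
      refine squeeze_zero (fun n => norm_nonneg _) (fun n => ?_) h1
      have hmem : l n - φ n ∈ Finset.range (M i) := by
        have := (hl n).2
        have := hle n
        rw [Finset.mem_range]; omega
      have h2 := Finset.single_le_sum (f := fun m => ‖x (φ n + m) - x (φ n)‖)
        (fun _ _ => norm_nonneg _) hmem
      simpa [Nat.add_sub_cancel' (hle n)] using h2
    -- Activation times may repeat, so a strictly increasing subsequence is extracted.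
    obtain ⟨ψ, hψ, hlψ⟩ := strictMono_subseq_of_tendsto_atTop hltop
    exact ⟨l ∘ ψ, hlψ, fun n => hil (ψ n), (hz.of_sub_tendsto_zero hdiff).comp_strictMono hψ⟩
  refine ⟨fun i => ?_, fun k => ?_⟩
  · obtain ⟨r, hr, hi, hw⟩ := key (Sum.inl i)
    refine he i z r hr hi hw ?_
    exact (h.tendsto_displacement hF hε hs hr hi).congr fun n => by rw [h.a_inl _ _ (hi n)]
  · obtain ⟨r, hr, hi, hw⟩ := key (Sum.inr k)
    have h1 : Tendsto (fun n => F k (x (r n))) atTop (𝓝 (p k)) := by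
      have := (h.tendsto_displacement hF hε hs hr hi).const_sub (p k)
      rw [sub_zero] at this
      refine this.congr fun n => ?_
      rw [h.a_inr _ _ (hi n)]; abel
    refine (hF k).eq_of_weaklyConverges (B := ‖s - x₀‖ + ‖s - z‖) (fun n => ?_) hw h1
    have h2 : ‖s - x (r n)‖ ≤ ‖s - x₀‖ := by
      refine le_of_sq_le_sq ?_ (norm_nonneg _)
      linarith [h.norm_sq_sub_add_le hF hε.le hs (r n), sq_nonneg ‖x (r n) - x₀‖]
    have h3 := norm_sub_le_norm_sub_add_norm_sub (x (r n)) s z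
    rw [norm_sub_rev (x (r n)) s] at h3
    linarith

/-- A weakly convergent subsequence of the iterates with feasible limit converges strongly. -/
theorem tendsto_of_weaklyConverges [CompleteSpace H]
    (h : IsAlgorithmRun C F p x₀ ε x I T a η j ω θ y lam t)
    (hF : ∀ k, FirmlyNonexpansive (F k)) (hε : 0 ≤ ε) {z : H} (hz : z ∈ feasibleSet C F p)
    {φ : ℕ → ℕ} (hw : WeaklyConverges (fun n => x (φ n)) z) :
    Tendsto (fun n => x (φ n)) atTop (𝓝 z) := by
  have h1 : Tendsto (fun n => inner ℝ (z - x (φ n)) (z - x₀)) atTop (𝓝 0) := by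
    have := (weaklyConverges_iff.1 hw (z - x₀)).const_sub (inner ℝ z (z - x₀))
    simpa [inner_sub_left] using this
  have h2 : Tendsto (fun n => ‖x (φ n) - z‖ ^ 2) atTop (𝓝 0) := by
    refine squeeze_zero (fun n => by positivity) (fun n => ?_) h1
    have h3 := (h.feasibleSet_subset hF hε (φ n) hz).1
    have e : z - x₀ = (z - x (φ n)) - (x₀ - x (φ n)) := by abel
    rw [e, inner_sub_right, real_inner_self_eq_norm_sq, norm_sub_rev]
    linarith
  rw [tendsto_iff_norm_sub_tendsto_zero]
  simpa using h2.sqrt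

/-- The strong limit of a subsequence satisfies the Pythagorean inequality of a projection. -/
theorem norm_sq_add_le_of_tendsto (h : IsAlgorithmRun C F p x₀ ε x I T a η j ω θ y lam t)
    (hF : ∀ k, FirmlyNonexpansive (F k)) (hε : 0 ≤ ε) {z w : H} {φ : ℕ → ℕ}
    (hlim : Tendsto (fun n => x (φ n)) atTop (𝓝 z)) (hw : w ∈ feasibleSet C F p) :
    ‖z - x₀‖ ^ 2 + ‖w - z‖ ^ 2 ≤ ‖w - x₀‖ ^ 2 :=
  le_of_tendsto (((hlim.sub_const x₀).norm.pow 2).add ((hlim.const_sub w).norm.pow 2))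
    (Eventually.of_forall fun n => h.norm_sq_sub_add_le hF hε hw (φ n))

end IsAlgorithmRun

end BestApprox

/-! ### Unique solvability and strong convergence -/

theorem corollary4p2
    {H : Type*} [NormedAddCommGroup H] [InnerProductSpace ℝ H] [CompleteSpace H]
    {J K : Type*} [Countable J] [Countable K] [Nonempty (J ⊕ K)]
    (x₀ : H) (C : J → Set H) (F : K → H → H) (p : K → H)
    (hC_closed : ∀ i, IsClosed (C i)) (hC_convex : ∀ i, Convex ℝ (C i))
    (hF : ∀ k, BestApprox.FirmlyNonexpansive (F k))
    (hfeas : ∃ xbar : H, (∀ i, xbar ∈ C i) ∧ ∀ k, F k xbar = p k)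
    (ε : ℝ) (hε : ε ∈ Set.Ioo (0 : ℝ) 1)
    (x : ℕ → H) (I : ℕ → Finset (J ⊕ K)) (T : J → ℕ → H → H) (a : J ⊕ K → ℕ → H)
    (η : J ⊕ K → ℕ → ℝ) (j : ℕ → J ⊕ K) (ω : J ⊕ K → ℕ → ℝ) (θ : ℕ → ℝ) (y : ℕ → H)
    (lam : ℕ → ℝ) (t : ℕ → H)
    (hrun : BestApprox.IsAlgorithmRun C F p x₀ ε x I T a η j ω θ y lam t)
    (hd : ∃ M : J ⊕ K → ℕ, (∀ i, 0 < M i) ∧ ∀ i n, ∃ l ∈ Set.Ico n (n + M i), i ∈ I l)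
    (he : ∀ (i : J) (z : H) (r : ℕ → ℕ), StrictMono r →
      (∀ n, Sum.inl i ∈ I (r n)) →
      BestApprox.WeaklyConverges (fun n => x (r n)) z →
      Filter.Tendsto (fun n => T i (r n) (x (r n)) - x (r n)) Filter.atTop (nhds 0) →
      z ∈ C i) :
    -- the steps of the algorithm are well defined
    (∀ n, θ n ≠ 0 → y n ≠ 0) ∧
    (∀ n, (BestApprox.haugazeauSet x₀ (x n) (t n)).Nonempty) ∧
    -- the problem has exactly one solution, and the iterates converge strongly to it
    ∃ z : H, BestApprox.IsBestApprox (BestApprox.feasibleSet C F p) x₀ z ∧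
      (∀ w, BestApprox.IsBestApprox (BestApprox.feasibleSet C F p) x₀ w → w = z) ∧
      Filter.Tendsto x Filter.atTop (nhds z) := by

  obtain ⟨s, hs⟩ : (BestApprox.feasibleSet C F p).Nonempty := hfeas
  have hε0 := hε.1
  have hbound : ∀ n, ‖x n‖ ≤ ‖s - x₀‖ + ‖x₀‖ := by
    intro n
    have h1 : ‖x n - x₀‖ ≤ ‖s - x₀‖ := by
      refine le_of_sq_le_sq ?_ (norm_nonneg _)
      linarith [hrun.norm_sq_sub_add_le hF hε0.le hs n, sq_nonneg ‖s - x n‖]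
    linarith [norm_le_norm_sub_add (x n) x₀]
  have hsub : ∀ ψ : ℕ → ℕ, StrictMono ψ → ∃ z ∈ BestApprox.feasibleSet C F p, ∃ φ : ℕ → ℕ,
      Tendsto (fun n => x (ψ (φ n))) atTop (𝓝 z) := by
    intro ψ hψ
    obtain ⟨z, φ, hφ, hw⟩ :=
      BestApprox.exists_weaklyConverges_subseq (u := fun n => x (ψ n)) fun n => hbound (ψ n)
    have hz := hrun.mem_feasibleSet_of_weaklyConverges hF hε0 ⟨s, hs⟩ hd he (hψ.comp hφ) hw
    exact ⟨z, hz, φ, hrun.tendsto_of_weaklyConverges hF hε0.le hz (φ := ψ ∘ φ) hw⟩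
  refine ⟨fun n hn => hrun.y_ne_zero hF hs hn,
    fun n => ⟨s, hrun.feasibleSet_subset hF hε0.le n hs⟩, ?_⟩
  obtain ⟨z, hz, φ, hφ⟩ := hsub id strictMono_id
  have hpyth : ∀ w ∈ BestApprox.feasibleSet C F p,
      ‖z - x₀‖ ^ 2 + ‖w - z‖ ^ 2 ≤ ‖w - x₀‖ ^ 2 :=
    fun w hw => hrun.norm_sq_add_le_of_tendsto hF hε0.le hφ hw
  have huniq : ∀ w ∈ BestApprox.feasibleSet C F p, ‖w - x₀‖ ≤ ‖z - x₀‖ → w = z := by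
    intro w hw hle
    have h1 := hpyth w hw
    have h2 : ‖w - x₀‖ ^ 2 ≤ ‖z - x₀‖ ^ 2 := by gcongr
    have h3 : ‖w - z‖ ^ 2 = 0 := le_antisymm (by linarith) (by positivity)
    rwa [sq_eq_zero_iff, norm_eq_zero, sub_eq_zero] at h3
  refine ⟨z, ⟨hz, fun w hw => ?_⟩, fun w hw => huniq w hw.1 (hw.2 hz), ?_⟩
  · refine le_of_sq_le_sq ?_ (norm_nonneg _)
    linarith [hpyth w hw, sq_nonneg ‖w - z‖]
  · refine tendsto_of_subseq_tendsto fun ns hns => ?_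
    obtain ⟨ψ, -, hψ⟩ := strictMono_subseq_of_tendsto_atTop hns
    obtain ⟨w, hw, χ, hχ⟩ := hsub _ hψ
    -- The Pythagorean inequality at the new limit `w`, tested at `z`, gives `‖w - x₀‖ ≤ ‖z - x₀‖`,
    -- so all subsequential limits coincide.
    have h1 := hrun.norm_sq_add_le_of_tendsto hF hε0.le (φ := (ns ∘ ψ) ∘ χ) hχ hz
    have hwz : w = z := by
      refine huniq w hw (le_of_sq_le_sq ?_ (norm_nonneg _))
      linarith [sq_nonneg ‖z - w‖]
    exact ⟨ψ ∘ χ, hwz ▸ hχ⟩
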